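/- Let $\mathcal X,\mathcal Y$ be finite sets, $P$ a probability mass function on $\mathcal X$, $W(\cdot|x)$, $x\in\mathcal X$, a channel from $\mathcal X$ to $\mathcal Y$ (each $W(\cdot|x)$ is a probability mass function on $\mathcal Y$), $q:\mathcal X\times\mathcal Y\to\mathbb R$ and $d:\mathcal X\times\mathcal X\to\mathbb R$ arbitrary functions ($d$ need not be symmetric), and $\Delta,R,\delta\in\mathbb R$. Extend $q$ and $d$ additively to joint distributions: $q(V_{XY})=\mathbb E_V[q(X,Y)]$, $d(V_{X\widetilde X})=\mathbb E_V[d(X,\widetilde X)]$. Logarithms are natural, $I$ is mutual information, $D(V_{Y|X}\|W|P)=\sum_x P(x)D(V_{Y|X}(\cdot|x)\|W(\cdot|x))\in[0,\infty]$ is conditional relative entropy, $|z|_+=\max\{z,0\}$, and a minimum over the empty set is $+\infty$. Define the RGV exponent $$E_{\mathrm{RGV}}(R,P,W,q,d,\Delta)=\min_{V_{X\widetilde XY}\in\mathcal T}\; D(V_{Y|X}\|W|P)+\bigl|I(\widetilde X;Y,X)-R\bigr|_+ ,$$ where $\mathcal T$ is the set of probability mass functions $V_{X\widetilde XY}$ on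 $\mathcal X\times\mathcal X\times\mathcal Y$ with $V_X=V_{\widetilde X}=P$, $q(V_{\widetilde XY})\ge q(V_{XY})$ and $d(V_{X\widetilde X})\ge\Delta$. Then, as an identity in $[0,\infty]$, $$E_{\mathrm{RGV}}(R,P,W,q,d,\Delta)=\sup_{\rho\in[0,1],\,r\ge0,\,s\ge0,\,a:\mathcal X\to\mathbb R}\;-\sum_xP(x)\log\sum_yW(y|x)\left(\frac{\sum_{x'}P(x')e^{sq(x',y)}e^{a(x')}e^{r(d(x,x')-\Delta)}}{e^{sq(x,y)}e^{a(x)}}\right)^{\rho}-\rho R .$$ Moreover, with $\phi_a=\sum_xP(x)a(x)$, $$\min_{P_{X\widetilde X}:\;d(P_{X\widetilde X})\le\Delta,\;P_X=P_{\widetilde X}=P} I(X;\widetilde X)=\sup_{r\ge0,\,a:\mathcal X\to\mathbb R}\;-\sum_xP(x)\log\sum_{x'}P(x')e^{a(x')-\phi_a}e^{-r(d(x,x')-\Delta)} ,$$ so that the rate condition $R\le\min_{P_{X\widetilde X}:\,d(P_{X\widetilde X})\le\Delta,\,P_X=P_{\widetilde X}=P}I(X;\widetilde X)-2\delta$ is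 equivalent to $$R\le\sup_{r\ge0,\,a:\mathcal X\to\mathbb R}\;-\sum_xP(x)\log\sum_{x'}P(x')e^{a(x')-\phi_a}e^{-r(d(x,x')-\Delta)}-2\delta .$$ Both minima are attained whenever their constraint sets are non-empty. -/

import Mathlib

open Real Set

noncomputable section

namespace RGV

variable {A B X Y : Type*} [Fintype A] [Fintype B] [Fintype X] [Fintype Y]

/-- First marginal of a joint mass function. -/
def fstMarg (V : A × B → ℝ) (a : A) : ℝ := ∑ b, V (a, b)

/-- Second marginal of a joint mass function. -/
def sndMarg (V : A × B → ℝ) (b : B) : ℝ := ∑ a, V (a, b)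

/-- Conditional mass function `V_{B|A}(b|a) = V(a,b) / V_A(a)`
(the zero function at those `a` with `V_A(a) = 0`). -/
def condMarg (V : A × B → ℝ) (a : A) (b : B) : ℝ := V (a, b) / fstMarg V a

open Classical in
/-- Relative entropy `D(p‖q)` in nats of mass functions on a finite set, with `0 log 0 = 0`;
it is `⊤` when `p` is not absolutely continuous with respect to `q`. -/
def relEntropy (p q : A → ℝ) : EReal :=
  if ∀ a, q a = 0 → p a = 0 then ((∑ a, p a * log (p a / q a) : ℝ) : EReal) else ⊤

/-- Conditional relative entropy `D(V‖W|P) = ∑ₓ P(x) D(V(·|x)‖W(·|x))`, where `0 * ⊤ = 0`. -/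
def condRelEntropy (V W : X → Y → ℝ) (P : X → ℝ) : EReal :=
  ∑ x, (P x : EReal) * relEntropy (V x) (W x)

/-- Mutual information in nats of a joint mass function on a finite product. -/
def mutualInfo (V : A × B → ℝ) : ℝ :=
  ∑ a, ∑ b, V (a, b) * log (V (a, b) / (fstMarg V a * sndMarg V b))

/-- The additive functional `V ↦ 𝔼_V[f(A,B)]` with single-letter function `f`. -/
def additive (f : A → B → ℝ) (V : A × B → ℝ) : ℝ := ∑ a, ∑ b, V (a, b) * f a b

/-! Joint mass functions of `(X, X̃, Y)` are functions on `X × X × Y`, in this order. -/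

/-- The marginal `V_{X X̃}`. -/
def margXXt (V : X × X × Y → ℝ) : X × X → ℝ := fun p => ∑ y, V (p.1, p.2, y)

/-- The marginal `V_{X Y}`. -/
def margXY (V : X × X × Y → ℝ) : X × Y → ℝ := fun p => ∑ x', V (p.1, x', p.2)

/-- The marginal `V_{X̃ Y}`. -/
def margXtY (V : X × X × Y → ℝ) : X × Y → ℝ := fun p => ∑ x, V (x, p.1, p.2)

/-- The mass function of the pair `(X̃, (X, Y))`. -/
def regroup (V : X × X × Y → ℝ) : X × (X × Y) → ℝ := fun p => V (p.2.1, p.1, p.2.2)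

/-- The constraint set of the exponent, for a type-dependent distance `d` and metric `q`. -/
def exponentSet (P : X → ℝ) (q : (X × Y → ℝ) → ℝ) (d : (X × X → ℝ) → ℝ) (Δ : ℝ) :
    Set (X × X × Y → ℝ) :=
  {V | V ∈ stdSimplex ℝ (X × X × Y) ∧
    fstMarg (margXXt V) = P ∧ sndMarg (margXXt V) = P ∧
    q (margXtY V) ≥ q (margXY V) ∧ d (margXXt V) ≥ Δ}

/-- `D(V_{Y|X}‖W|P) + |I(X̃;Y,X) - R|₊`. -/
def exponentObj (R : ℝ) (P : X → ℝ) (W : X → Y → ℝ) (V : X × X × Y → ℝ) : EReal :=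
  condRelEntropy (condMarg (margXY V)) W P + ((max (mutualInfo (regroup V) - R) 0 : ℝ) : EReal)

/-- The RGV exponent (`⊤` if the constraint set is empty). -/
def ERGV (R : ℝ) (P : X → ℝ) (W : X → Y → ℝ) (q : (X × Y → ℝ) → ℝ)
    (d : (X × X → ℝ) → ℝ) (Δ : ℝ) : EReal :=
  ⨅ V ∈ exponentSet P q d Δ, exponentObj R P W V

/-- The constraint set of the rate condition. -/
def rateSet (P : X → ℝ) (d : (X × X → ℝ) → ℝ) (Δ : ℝ) : Set (X × X → ℝ) :=
  {V | V ∈ stdSimplex ℝ (X × X) ∧ d V ≤ Δ ∧ fstMarg V = P ∧ sndMarg V = P}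

/-- The minimum of `I(X;X̃)` over the constraint set of the rate condition
(`⊤` if that set is empty). -/
def rateMin (P : X → ℝ) (d : (X × X → ℝ) → ℝ) (Δ : ℝ) : EReal :=
  ⨅ V ∈ rateSet P d Δ, (mutualInfo V : EReal)

/-- The expression optimized in the dual form of the exponent. -/
def dualExponentObj (R : ℝ) (P : X → ℝ) (W : X → Y → ℝ) (q : X → Y → ℝ) (d : X → X → ℝ)
    (Δ ρ r s : ℝ) (a : X → ℝ) : ℝ :=
  -(∑ x, P x * log (∑ y, W x y *
      ((∑ x', P x' * exp (s * q x' y) * exp (a x') * exp (r * (d x x' - Δ))) /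
        (exp (s * q x y) * exp (a x))) ^ ρ)) - ρ * R

/-- The expression optimized in the dual form of the rate condition, with `φ_a = 𝔼_P[a(X)]`. -/
def dualRateObj (P : X → ℝ) (d : X → X → ℝ) (Δ r : ℝ) (a : X → ℝ) : ℝ :=
  -(∑ x, P x * log (∑ x', P x' * exp (a x' - ∑ z, P z * a z) * exp (-r * (d x x' - Δ))))

end RGV

end

noncomputable section

namespace RGV

set_option linter.unusedSectionVars false

variable {A B X Y : Type*} [Fintype A] [Fintype B] [Fintype X] [Fintype Y]

/-! The identity is Lagrangian duality followed by an explicit minimization. Restrict to laws with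
`V_X = P` that vanish wherever `W` or `P(x')` does: this set is convex and compact, and the
divergences are finite, continuous and convex there. In the information term the marginal of `X̃` is
replaced by the fixed law `P`. This changes nothing on the constraint set and makes the term jointly
convex while `V_X̃ = P` is still a penalized constraint. Multipliers `s`, `r`, `a` penalize the
metric, distance and marginal constraints, and `|z|₊` is the supremum of `ρ z` over `0 < ρ ≤ 1`. The
supremum over multipliers is thus the objective at feasible laws and `⊤` elsewhere
(`of_lagrangian_le`, `ERGV_eq_iInf_iSup`). Sion's theorem exchanges infimum and supremum
(`iInf_iSup_lagrangian`).

For fixed multipliers, `lagrangian_eq` writes the Lagrangian as the dual expression plus two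
nonnegative divergences, both zero at an exponentially tilted law. Hence `iInf_lagrangian`. This
uses multipliers scaled by `ρ`, so `ρ = 0` is left out of the minimax and restored at the end, where
its value is only `0`.

The rate threshold needs no second duality argument: it is the exponent of a one-output channel with
zero metric, negated distance and zero rate. -/

/-! ### The function `(p, q) ↦ p log (p / q)` -/

/-- Pointwise form of Gibbs' inequality. -/
theorem sub_le_mul_log_div {p q : ℝ} (hp : 0 ≤ p) (hq : 0 ≤ q) (h : q = 0 → p = 0) :
    p - q ≤ p * log (p / q) := by
  rcases hp.eq_or_lt with rfl | hp'
  · simpa using hq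
  have hq' : 0 < q := hq.lt_of_ne fun e => hp'.ne' (h e.symm)
  have h1 := mul_le_mul_of_nonneg_left (one_sub_inv_le_log_of_pos (div_pos hp' hq')) hp
  have h2 : p * (1 - (p / q)⁻¹) = p - q := by field_simp
  linarith

theorem mul_log_div_mul {p q c : ℝ} (hc : c ≠ 0) (h : q = 0 → p = 0) :
    p * log (p / (q * c)) = p * log (p / q) - p * log c := by
  rcases eq_or_ne p 0 with rfl | hp
  · simp
  have hq : q ≠ 0 := fun e => hp (h e)
  rw [← div_div, log_div (div_ne_zero hp hq) hc, mul_sub]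

theorem mul_log_div_self (p : ℝ) : p * log (p / p) = 0 := by
  rcases eq_or_ne p 0 with rfl | hp <;> simp [*]

theorem mul_log_div {p q : ℝ} (h : q = 0 → p = 0) :
    p * log (p / q) = p * log p - p * log q := by
  rcases eq_or_ne p 0 with rfl | hp
  · simp
  rw [log_div hp fun e => hp (h e), mul_sub]

/-- Joint convexity of `(p, q) ↦ p log (p / q)`. -/
theorem mul_log_div_convex {p₁ q₁ p₂ q₂ α β : ℝ} (hp₁ : 0 ≤ p₁) (hq₁ : 0 ≤ q₁)
    (h₁ : q₁ = 0 → p₁ = 0) (hp₂ : 0 ≤ p₂) (hq₂ : 0 ≤ q₂) (h₂ : q₂ = 0 → p₂ = 0)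
    (hα : 0 ≤ α) (hβ : 0 ≤ β) :
    (α * p₁ + β * p₂) * log ((α * p₁ + β * p₂) / (α * q₁ + β * q₂)) ≤
      α * (p₁ * log (p₁ / q₁)) + β * (p₂ * log (p₂ / q₂)) := by
  have e₁ := mul_nonneg hα hp₁
  have e₂ := mul_nonneg hβ hp₂
  have f₁ := mul_nonneg hα hq₁
  have f₂ := mul_nonneg hβ hq₂
  rcases (add_nonneg e₁ e₂).eq_or_lt with h0 | hpos
  · have z₁ : α * p₁ = 0 := by linarith
    have z₂ : β * p₂ = 0 := by linarith
    simp [← mul_assoc, z₁, z₂]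
  have hq : 0 < α * q₁ + β * q₂ := by
    refine (add_nonneg f₁ f₂).lt_of_ne fun e => hpos.ne ?_
    have z₁ : α * q₁ = 0 := by linarith
    have z₂ : β * q₂ = 0 := by linarith
    have y₁ : α * p₁ = 0 := by
      rcases mul_eq_zero.1 z₁ with z | z
      · rw [z, zero_mul]
      · rw [h₁ z, mul_zero]
    have y₂ : β * p₂ = 0 := by
      rcases mul_eq_zero.1 z₂ with z | z
      · rw [z, zero_mul]
      · rw [h₂ z, mul_zero]
    rw [y₁, y₂, add_zero]
  -- At this common slope the tangent bounds below add up with no remainder, since `c` times the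
  -- mixed second argument is the mixed first argument.
  set c := (α * p₁ + β * p₂) / (α * q₁ + β * q₂) with hc
  have hc0 : 0 < c := div_pos hpos hq
  have key : ∀ {p q : ℝ}, 0 ≤ p → 0 ≤ q → (q = 0 → p = 0) →
      p - q * c + p * log c ≤ p * log (p / q) := by
    intro p q hp hq h
    have := sub_le_mul_log_div hp (mul_nonneg hq hc0.le)
      (fun e => h ((mul_eq_zero.1 e).resolve_right hc0.ne'))
    rw [mul_log_div_mul hc0.ne' h] at this
    linarith
  have k₁ := mul_le_mul_of_nonneg_left (key hp₁ hq₁ h₁) hα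
  have k₂ := mul_le_mul_of_nonneg_left (key hp₂ hq₂ h₂) hβ
  have hcq : (α * q₁ + β * q₂) * c = α * p₁ + β * p₂ := by rw [hc]; field_simp
  linarith

/-! ### The Lagrangian -/

/-- The joint mass functions with `X`-marginal `P` that are supported where the channel `W` and
the law `P` of `X̃` are positive. -/
def supportedSet (P : X → ℝ) (W : X → Y → ℝ) : Set (X × X × Y → ℝ) :=
  {V | V ∈ stdSimplex ℝ (X × X × Y) ∧ fstMarg (margXXt V) = P ∧
    ∀ x x' y, W x y = 0 ∨ P x' = 0 → V (x, x', y) = 0}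

/-- The divergence `D(V_{XY}‖P × W)`. -/
def channelDiv (P : X → ℝ) (W : X → Y → ℝ) (V : X × X × Y → ℝ) : ℝ :=
  ∑ x, ∑ y, margXY V (x, y) * log (margXY V (x, y) / (P x * W x y))

/-- The divergence `D(V_{X̃XY}‖P × V_{XY})`. -/
def infoDiv (P : X → ℝ) (V : X × X × Y → ℝ) : ℝ :=
  ∑ x, ∑ y, ∑ x', V (x, x', y) * log (V (x, x', y) / (P x' * margXY V (x, y)))

/-- The penalty for violating the linear constraints of the exponent. -/
def penalty (P : X → ℝ) (q : X → Y → ℝ) (d : X → X → ℝ) (Δ r s : ℝ) (a : X → ℝ)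
    (V : X × X × Y → ℝ) : ℝ :=
  s * (additive q (margXY V) - additive q (margXtY V)) + r * (Δ - additive d (margXXt V)) +
    ∑ x, a x * (P x - sndMarg (margXXt V) x)

/-- The Lagrangian of the exponent with multipliers `(ρ, r, s, a)`. -/
def lagrangian (R : ℝ) (P : X → ℝ) (W : X → Y → ℝ) (q : X → Y → ℝ) (d : X → X → ℝ) (Δ : ℝ)
    (V : X × X × Y → ℝ) (m : ℝ × ℝ × ℝ × (X → ℝ)) : ℝ :=
  channelDiv P W V + m.1 * (infoDiv P V - R) + penalty P q d Δ m.2.1 m.2.2.1 m.2.2.2 V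

/-- The admissible multipliers. -/
def multipliers (X : Type*) : Set (ℝ × ℝ × ℝ × (X → ℝ)) :=
  {m | m.1 ∈ Ioc (0 : ℝ) 1 ∧ 0 ≤ m.2.1 ∧ 0 ≤ m.2.2.1}

/-! ### Marginals and supports. -/

section supported

variable {P : X → ℝ} {W : X → Y → ℝ} {V : X × X × Y → ℝ}

theorem fstMarg_margXY (V : X × X × Y → ℝ) (x : X) :
    fstMarg (margXY V) x = fstMarg (margXXt V) x := by
  simp only [fstMarg, margXY, margXXt]
  exact Finset.sum_comm

theorem sum_margXY (hV : fstMarg (margXXt V) = P) (x : X) : ∑ y, margXY V (x, y) = P x := by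
  rw [← hV, ← fstMarg_margXY, fstMarg]

theorem margXY_nonneg (hV : ∀ z, 0 ≤ V z) (z : X × Y) : 0 ≤ margXY V z :=
  Finset.sum_nonneg fun _ _ => hV _

theorem eq_zero_of_margXY (hV : ∀ z, 0 ≤ V z) {x : X} {y : Y} (h : margXY V (x, y) = 0) (x' : X) :
    V (x, x', y) = 0 :=
  (Finset.sum_eq_zero_iff_of_nonneg fun _ _ => hV _).1 h x' (Finset.mem_univ _)

theorem margXY_eq_zero_of_fst (hV : ∀ z, 0 ≤ V z) (hm : fstMarg (margXXt V) = P) {x : X}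
    (h : P x = 0) (y : Y) : margXY V (x, y) = 0 := by
  rw [← sum_margXY hm] at h
  exact (Finset.sum_eq_zero_iff_of_nonneg fun _ _ => margXY_nonneg hV _).1 h y (Finset.mem_univ _)

theorem margXY_eq_zero_of_mem (hV : V ∈ supportedSet P W) {x : X} {y : Y}
    (h : P x * W x y = 0) : margXY V (x, y) = 0 := by
  rcases mul_eq_zero.1 h with h | h
  · exact margXY_eq_zero_of_fst hV.1.1 hV.2.1 h y
  · exact Finset.sum_eq_zero fun x' _ => hV.2.2 x x' y (Or.inl h)

theorem eq_zero_of_mem (hV : V ∈ supportedSet P W) {x x' : X} {y : Y}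
    (h : P x' * margXY V (x, y) = 0) : V (x, x', y) = 0 := by
  rcases mul_eq_zero.1 h with h | h
  · exact hV.2.2 x x' y (Or.inr h)
  · exact eq_zero_of_margXY hV.1.1 h x'

end supported

/-! ### Linear dependence of the marginals on the law. -/

theorem margXY_comb (α β : ℝ) (U V : X × X × Y → ℝ) (z : X × Y) :
    margXY (α • U + β • V) z = α * margXY U z + β * margXY V z := by
  simp [margXY, Finset.sum_add_distrib, Finset.mul_sum]

theorem margXtY_comb (α β : ℝ) (U V : X × X × Y → ℝ) (z : X × Y) :
    margXtY (α • U + β • V) z = α * margXtY U z + β * margXtY V z := by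
  simp [margXtY, Finset.sum_add_distrib, Finset.mul_sum]

theorem margXXt_comb (α β : ℝ) (U V : X × X × Y → ℝ) (z : X × X) :
    margXXt (α • U + β • V) z = α * margXXt U z + β * margXXt V z := by
  simp [margXXt, Finset.sum_add_distrib, Finset.mul_sum]

theorem additive_comb (f : A → B → ℝ) {α β : ℝ} {T U V : A × B → ℝ}
    (h : ∀ z, T z = α * U z + β * V z) :
    additive f T = α * additive f U + β * additive f V := by
  simp only [additive, h, add_mul, Finset.sum_add_distrib, Finset.mul_sum, mul_assoc]

theorem sndMarg_comb {α β : ℝ} {T U V : A × B → ℝ} (h : ∀ z, T z = α * U z + β * V z) (b : B) :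
    sndMarg T b = α * sndMarg U b + β * sndMarg V b := by
  simp only [sndMarg, h, Finset.sum_add_distrib, Finset.mul_sum]

theorem fstMarg_comb {α β : ℝ} {T U V : A × B → ℝ} (h : ∀ z, T z = α * U z + β * V z) (a : A) :
    fstMarg T a = α * fstMarg U a + β * fstMarg V a := by
  simp only [fstMarg, h, Finset.sum_add_distrib, Finset.mul_sum]

theorem convex_supportedSet (P : X → ℝ) (W : X → Y → ℝ) : Convex ℝ (supportedSet P W) := by
  rintro U ⟨hU, hU', hU''⟩ V ⟨hV, hV', hV''⟩ α β hα hβ hαβ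
  refine ⟨convex_stdSimplex ℝ _ hU hV hα hβ hαβ, ?_, fun x x' y h => ?_⟩
  · ext x
    rw [fstMarg_comb (margXXt_comb α β U V), hU', hV', ← add_mul, hαβ, one_mul]
  · simp [hU'' x x' y h, hV'' x x' y h]

theorem isCompact_supportedSet (P : X → ℝ) (W : X → Y → ℝ) : IsCompact (supportedSet P W) := by
  have h₁ : IsClosed {V : X × X × Y → ℝ | fstMarg (margXXt V) = P} := by
    refine isClosed_eq ?_ continuous_const
    unfold fstMarg margXXt
    fun_prop
  have h₂ : IsClosed {V : X × X × Y → ℝ |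
      ∀ x x' y, W x y = 0 ∨ P x' = 0 → V (x, x', y) = 0} := by
    simp only [ofPred_forall]
    exact isClosed_iInter fun x => isClosed_iInter fun x' => isClosed_iInter fun y =>
      isClosed_iInter fun _ => isClosed_eq (by fun_prop) continuous_const
  exact (isCompact_stdSimplex ℝ (X × X × Y)).inter_right (h₁.inter h₂)

/-! ### Convexity and continuity of the divergences and the penalty. -/

theorem channelDiv_convex {P : X → ℝ} {W : X → Y → ℝ} (hP : ∀ x, 0 ≤ P x)
    (hW : ∀ x y, 0 ≤ W x y) : ConvexOn ℝ (supportedSet P W) (channelDiv P W) := by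
  refine ⟨convex_supportedSet P W, fun U hU V hV α β hα hβ hαβ => ?_⟩
  simp only [channelDiv, smul_eq_mul, Finset.mul_sum, ← Finset.sum_add_distrib]
  refine Finset.sum_le_sum fun x _ => Finset.sum_le_sum fun y _ => ?_
  have h := mul_nonneg (hP x) (hW x y)
  have := mul_log_div_convex (margXY_nonneg hU.1.1 (x, y)) h (margXY_eq_zero_of_mem hU)
    (margXY_nonneg hV.1.1 (x, y)) h (margXY_eq_zero_of_mem hV) hα hβ
  rwa [← add_mul, hαβ, one_mul, ← margXY_comb] at this

/-- With `P` fixed as the law of `X̃`, both arguments of each term are linear in `V`, so joint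
convexity of `p log (p / q)` applies termwise. -/
theorem infoDiv_convex {P : X → ℝ} (W : X → Y → ℝ) (hP : ∀ x, 0 ≤ P x) :
    ConvexOn ℝ (supportedSet P W) (infoDiv P) := by
  refine ⟨convex_supportedSet P W, fun U hU V hV α β hα hβ hαβ => ?_⟩
  simp only [infoDiv, smul_eq_mul, Finset.mul_sum, ← Finset.sum_add_distrib]
  refine Finset.sum_le_sum fun x _ => Finset.sum_le_sum fun y _ =>
    Finset.sum_le_sum fun x' _ => ?_
  have := mul_log_div_convex (hU.1.1 (x, x', y)) (mul_nonneg (hP x') (margXY_nonneg hU.1.1 (x, y)))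
    (eq_zero_of_mem hU) (hV.1.1 (x, x', y)) (mul_nonneg (hP x') (margXY_nonneg hV.1.1 (x, y)))
    (eq_zero_of_mem hV) hα hβ
  convert! this using 4
  rw [margXY_comb]
  ring

theorem penalty_comb (P : X → ℝ) (q : X → Y → ℝ) (d : X → X → ℝ) (Δ r s : ℝ) (a : X → ℝ)
    (U V : X × X × Y → ℝ) {α β : ℝ} (h : α + β = 1) :
    penalty P q d Δ r s a (α • U + β • V) =
      α * penalty P q d Δ r s a U + β * penalty P q d Δ r s a V := by
  obtain rfl : β = 1 - α := by linarith
  have : ∑ x, a x * (P x - sndMarg (margXXt (α • U + (1 - α) • V)) x) =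
      α * ∑ x, a x * (P x - sndMarg (margXXt U) x) +
        (1 - α) * ∑ x, a x * (P x - sndMarg (margXXt V) x) := by
    simp only [Finset.mul_sum, ← Finset.sum_add_distrib, sndMarg_comb (margXXt_comb _ _ U V)]
    exact Finset.sum_congr rfl fun x _ => by ring
  simp only [penalty, additive_comb _ (margXY_comb _ _ U V), additive_comb _ (margXtY_comb _ _ U V),
    additive_comb _ (margXXt_comb _ _ U V), this]
  ring

/-- The support conditions allow the logarithm of the quotient to be split, leaving multiples of `t
log t` and linear terms, which are continuous up to the boundary. -/
theorem continuousOn_channelDiv (P : X → ℝ) (W : X → Y → ℝ) :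
    ContinuousOn (channelDiv P W) (supportedSet P W) := by
  have h : Continuous fun V : X × X × Y → ℝ => ∑ x, ∑ y,
      (margXY V (x, y) * log (margXY V (x, y)) - margXY V (x, y) * log (P x * W x y)) := by
    have hm : ∀ z, Continuous fun V : X × X × Y → ℝ => margXY V z := fun z => by
      unfold margXY; fun_prop
    exact continuous_finsetSum _ fun x _ => continuous_finsetSum _ fun y _ =>
      (continuous_mul_log.comp (hm _)).sub ((hm _).mul continuous_const)
  refine h.continuousOn.congr fun V hV => ?_
  exact Finset.sum_congr rfl fun x _ => Finset.sum_congr rfl fun y _ =>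
    mul_log_div (margXY_eq_zero_of_mem hV)

theorem continuousOn_infoDiv (P : X → ℝ) (W : X → Y → ℝ) :
    ContinuousOn (infoDiv P) (supportedSet P W) := by
  have h : Continuous fun V : X × X × Y → ℝ => ∑ x, ∑ y,
      ((∑ x', (V (x, x', y) * log (V (x, x', y)) - V (x, x', y) * log (P x'))) -
        margXY V (x, y) * log (margXY V (x, y))) := by
    have hm : ∀ z, Continuous fun V : X × X × Y → ℝ => margXY V z := fun z => by
      unfold margXY; fun_prop
    exact continuous_finsetSum _ fun x _ => continuous_finsetSum _ fun y _ =>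
      (continuous_finsetSum _ fun x' _ => (continuous_mul_log.comp (continuous_apply _)).sub
        ((continuous_apply _).mul continuous_const)).sub (continuous_mul_log.comp (hm _))
  refine h.continuousOn.congr fun V hV => ?_
  refine Finset.sum_congr rfl fun x _ => Finset.sum_congr rfl fun y _ => ?_
  have hm : margXY V (x, y) * log (margXY V (x, y)) =
      ∑ x', V (x, x', y) * log (margXY V (x, y)) := by
    rw [← Finset.sum_mul]
    rfl
  rw [hm, ← Finset.sum_sub_distrib]
  refine Finset.sum_congr rfl fun x' _ => ?_
  rcases eq_or_ne (V (x, x', y)) 0 with h0 | h0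
  · simp [h0]
  have h1 : P x' * margXY V (x, y) ≠ 0 := fun e => h0 (eq_zero_of_mem hV e)
  rw [mul_log_div (eq_zero_of_mem hV), log_mul (left_ne_zero_of_mul h1) (right_ne_zero_of_mul h1)]
  ring

theorem continuous_penalty (P : X → ℝ) (q : X → Y → ℝ) (d : X → X → ℝ) (Δ r s : ℝ) (a : X → ℝ) :
    Continuous (penalty P q d Δ r s a) := by
  unfold penalty additive sndMarg margXY margXtY margXXt
  fun_prop

/-! ### The minimax exchange. -/

section lagrangian

variable (R : ℝ) {P : X → ℝ} {W : X → Y → ℝ} (q : X → Y → ℝ) (d : X → X → ℝ) (Δ : ℝ)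

theorem continuousOn_lagrangian (m : ℝ × ℝ × ℝ × (X → ℝ)) :
    ContinuousOn (fun V => lagrangian R P W q d Δ V m) (supportedSet P W) :=
  ((continuousOn_channelDiv P W).add (continuousOn_const.mul
    ((continuousOn_infoDiv P W).sub continuousOn_const))).add
    (continuous_penalty P q d Δ _ _ _).continuousOn

theorem lagrangian_convex (hP : ∀ x, 0 ≤ P x) (hW : ∀ x y, 0 ≤ W x y)
    {m : ℝ × ℝ × ℝ × (X → ℝ)} (hm : 0 ≤ m.1) :
    ConvexOn ℝ (supportedSet P W) fun V => lagrangian R P W q d Δ V m := by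
  refine ⟨convex_supportedSet P W, fun U hU V hV α β hα hβ hαβ => ?_⟩
  have h₁ := (channelDiv_convex hP hW).2 hU hV hα hβ hαβ
  have h₂ := mul_le_mul_of_nonneg_left ((infoDiv_convex W hP).2 hU hV hα hβ hαβ) hm
  simp only [lagrangian, penalty_comb P q d Δ _ _ _ U V hαβ, smul_eq_mul] at h₁ h₂ ⊢
  obtain rfl : β = 1 - α := by linarith
  linarith

theorem continuous_lagrangian_right (V : X × X × Y → ℝ) :
    Continuous (lagrangian R P W q d Δ V) := by
  unfold lagrangian penalty
  fun_prop

theorem convex_multipliers : Convex ℝ (multipliers X) := by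
  rintro m ⟨h₁, h₂, h₃⟩ n ⟨k₁, k₂, k₃⟩ α β hα hβ hαβ
  refine ⟨convex_Ioc (𝕜 := ℝ) 0 1 h₁ k₁ hα hβ hαβ, ?_, ?_⟩ <;> simp <;> positivity

/-- For fixed `V` the Lagrangian is affine in the multipliers, so equality holds. -/
theorem lagrangian_concave (V : X × X × Y → ℝ) :
    ConcaveOn ℝ (multipliers X) (lagrangian R P W q d Δ V) := by
  refine ⟨convex_multipliers, fun m _ n _ α β _ _ hαβ => le_of_eq ?_⟩
  obtain rfl : β = 1 - α := by linarith
  have : ∑ x, (α * m.2.2.2 x + (1 - α) * n.2.2.2 x) * (P x - sndMarg (margXXt V) x) =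
      α * ∑ x, m.2.2.2 x * (P x - sndMarg (margXXt V) x) +
        (1 - α) * ∑ x, n.2.2.2 x * (P x - sndMarg (margXXt V) x) := by
    simp only [Finset.mul_sum, ← Finset.sum_add_distrib]
    exact Finset.sum_congr rfl fun x _ => by ring
  simp only [lagrangian, penalty, smul_eq_mul, Prod.fst_add, Prod.snd_add, Prod.smul_fst,
    Prod.smul_snd, Pi.add_apply, Pi.smul_apply, this]
  ring

/-- Compactness is needed only on the side of `V`; the multipliers may be unbounded because values
are taken in `EReal`. -/
theorem iInf_iSup_lagrangian (hP : ∀ x, 0 ≤ P x) (hW : ∀ x y, 0 ≤ W x y)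
    (hne : (supportedSet P W).Nonempty) :
    (⨅ V ∈ supportedSet P W, ⨆ m ∈ multipliers X, (lagrangian R P W q d Δ V m : EReal)) =
      ⨆ m ∈ multipliers X, ⨅ V ∈ supportedSet P W, (lagrangian R P W q d Δ V m : EReal) := by
  refine Sion.minimax' (f := fun V m => (lagrangian R P W q d Δ V m : EReal)) hne
    (convex_supportedSet P W) (isCompact_supportedSet P W) (fun m _ => ?_) (fun m hm => ?_)
    convex_multipliers (fun V _ => ?_) (fun V _ => ?_)
  · exact (continuous_coe_real_ereal.comp_continuousOn
      (continuousOn_lagrangian R q d Δ m)).lowerSemicontinuousOn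
  · exact (lagrangian_convex R q d Δ hP hW hm.1.1.le).quasiconvexOn.monotone_comp
      (g := Real.toEReal) EReal.coe_strictMono.monotone
  · exact (continuous_coe_real_ereal.comp
      (continuous_lagrangian_right R q d Δ V)).continuousOn.upperSemicontinuousOn
  · exact (lagrangian_concave R q d Δ V).quasiconcaveOn.monotone_comp
      (g := Real.toEReal) EReal.coe_strictMono.monotone

end lagrangian

/-! ### Minimizing the Lagrangian -/

/-- The quantity raised to the power `ρ` in the dual form of the exponent. -/
def tiltSum (P : X → ℝ) (q : X → Y → ℝ) (d : X → X → ℝ) (Δ r s : ℝ) (a : X → ℝ)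
    (x : X) (y : Y) : ℝ :=
  (∑ x', P x' * exp (s * q x' y) * exp (a x') * exp (r * (d x x' - Δ))) /
    (exp (s * q x y) * exp (a x))

/-- The argument of the outer logarithm in the dual form of the exponent. -/
def outputSum (P : X → ℝ) (W : X → Y → ℝ) (q : X → Y → ℝ) (d : X → X → ℝ) (Δ ρ r s : ℝ)
    (a : X → ℝ) (x : X) : ℝ :=
  ∑ y, W x y * tiltSum P q d Δ r s a x y ^ ρ

/-- The exponent of the tilting factor. -/
def tilt (q : X → Y → ℝ) (d : X → X → ℝ) (Δ r s : ℝ) (a : X → ℝ) (x x' : X) (y : Y) : ℝ :=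
  s * (q x' y - q x y) + (a x' - a x) + r * (d x x' - Δ)

section gibbs

variable {P : X → ℝ} {W : X → Y → ℝ} (q : X → Y → ℝ) (d : X → X → ℝ) (Δ : ℝ)

theorem tiltSum_eq (r s : ℝ) (a : X → ℝ) (x : X) (y : Y) :
    tiltSum P q d Δ r s a x y = ∑ x', P x' * exp (tilt q d Δ r s a x x' y) := by
  rw [tiltSum, Finset.sum_div]
  refine Finset.sum_congr rfl fun x' _ => ?_
  rw [mul_assoc, mul_assoc, mul_div_assoc, ← exp_add, ← exp_add, ← exp_add, ← exp_sub]
  congr 2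
  rw [tilt]
  ring

theorem tiltSum_pos (hP : P ∈ stdSimplex ℝ X) (r s : ℝ) (a : X → ℝ) (x : X) (y : Y) :
    0 < tiltSum P q d Δ r s a x y := by
  rw [tiltSum_eq]
  obtain ⟨z, hz⟩ : ∃ z, P z ≠ 0 := by
    by_contra! h
    simpa [h] using hP.2
  exact Finset.sum_pos' (fun i _ => mul_nonneg (hP.1 i) (exp_pos _).le)
    ⟨z, Finset.mem_univ _, mul_pos ((hP.1 z).lt_of_ne' hz) (exp_pos _)⟩

theorem outputSum_pos (hP : P ∈ stdSimplex ℝ X) (hW : ∀ x, W x ∈ stdSimplex ℝ Y) (ρ r s : ℝ)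
    (a : X → ℝ) (x : X) : 0 < outputSum P W q d Δ ρ r s a x := by
  obtain ⟨z, hz⟩ : ∃ z, W x z ≠ 0 := by
    by_contra! h
    simpa [h] using (hW x).2
  have h := fun y => rpow_pos_of_pos (tiltSum_pos q d Δ hP r s a x y) ρ
  exact Finset.sum_pos' (fun i _ => mul_nonneg ((hW x).1 i) (h i).le)
    ⟨z, Finset.mem_univ _, mul_pos (((hW x).1 z).lt_of_ne' hz) (h z)⟩

theorem dualExponentObj_eq (R ρ r s : ℝ) (a : X → ℝ) :
    dualExponentObj R P W q d Δ ρ r s a =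
      -(∑ x, P x * log (outputSum P W q d Δ ρ r s a x)) - ρ * R := rfl

/-- The constants `Δ` and `P x` become averages under `V` by total mass one and `V_X = P`; the whole
penalty is then minus the mean of the tilting exponent. -/
theorem penalty_eq {V : X × X × Y → ℝ} (hV : fstMarg (margXXt V) = P)
    (hV1 : ∑ z, V z = 1) (r s : ℝ) (a : X → ℝ) :
    penalty P q d Δ r s a V = -∑ x, ∑ y, ∑ x', V (x, x', y) * tilt q d Δ r s a x x' y := by
  have e₁ : additive q (margXY V) = ∑ x, ∑ y, ∑ x', V (x, x', y) * q x y := by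
    simp only [additive, margXY, Finset.sum_mul]
  have e₂ : additive q (margXtY V) = ∑ x, ∑ y, ∑ x', V (x, x', y) * q x' y := by
    simp only [additive, margXtY, Finset.sum_mul]
    calc ∑ x', ∑ y, ∑ x, V (x, x', y) * q x' y
        = ∑ x', ∑ x, ∑ y, V (x, x', y) * q x' y :=
          Finset.sum_congr rfl fun _ _ => Finset.sum_comm
      _ = ∑ x, ∑ x', ∑ y, V (x, x', y) * q x' y := Finset.sum_comm
      _ = _ := Finset.sum_congr rfl fun _ _ => Finset.sum_comm
  have e₃ : additive d (margXXt V) = ∑ x, ∑ y, ∑ x', V (x, x', y) * d x x' := by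
    simp only [additive, margXXt, Finset.sum_mul]
    exact Finset.sum_congr rfl fun _ _ => Finset.sum_comm
  have e₄ : Δ = ∑ x, ∑ y, ∑ x', V (x, x', y) * Δ := by
    have : ∑ x, ∑ y, ∑ x', V (x, x', y) = 1 := by
      rw [← hV1, Fintype.sum_prod_type]
      refine Finset.sum_congr rfl fun _ _ => ?_
      rw [Fintype.sum_prod_type]
      exact Finset.sum_comm
    simp only [← Finset.sum_mul, this, one_mul]
  have e₅ : ∑ x, a x * P x = ∑ x, ∑ y, ∑ x', V (x, x', y) * a x := by
    refine Finset.sum_congr rfl fun x _ => ?_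
    rw [← hV, mul_comm]
    simp only [fstMarg, margXXt, Finset.sum_mul]
    exact Finset.sum_comm
  have e₆ : ∑ x, a x * sndMarg (margXXt V) x = ∑ x, ∑ y, ∑ x', V (x, x', y) * a x' := by
    simp only [sndMarg, margXXt, Finset.mul_sum]
    calc ∑ x', ∑ x, ∑ y, a x' * V (x, x', y)
        = ∑ x, ∑ x', ∑ y, a x' * V (x, x', y) := Finset.sum_comm
      _ = ∑ x, ∑ y, ∑ x', a x' * V (x, x', y) :=
          Finset.sum_congr rfl fun _ _ => Finset.sum_comm
      _ = _ := by simp only [mul_comm]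
  rw [penalty]
  simp only [mul_sub, Finset.sum_sub_distrib]
  rw [e₁, e₂, e₃, e₅, e₆]
  nth_rewrite 1 [e₄]
  simp only [Finset.mul_sum, ← Finset.sum_sub_distrib, ← Finset.sum_add_distrib,
    ← Finset.sum_neg_distrib]
  refine Finset.sum_congr rfl fun x _ => Finset.sum_congr rfl fun y _ =>
    Finset.sum_congr rfl fun x' _ => ?_
  rw [tilt]
  ring

/-- Scaling the multipliers by `ρ` lets the penalty join the information term under a common factor
`ρ`. -/
theorem penalty_mul (ρ r s : ℝ) (a : X → ℝ) (V : X × X × Y → ℝ) :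
    penalty P q d Δ (ρ * r) (ρ * s) (ρ • a) V = ρ * penalty P q d Δ r s a V := by
  simp only [penalty, mul_add, Finset.mul_sum, Pi.smul_apply, smul_eq_mul, mul_assoc]

/-- The Lagrangian is the dual objective plus two divergences. -/
theorem lagrangian_eq (hP : P ∈ stdSimplex ℝ X) (hW : ∀ x, W x ∈ stdSimplex ℝ Y)
    {V : X × X × Y → ℝ} (hV : V ∈ supportedSet P W) (R ρ r s : ℝ) (a : X → ℝ) :
    lagrangian R P W q d Δ V (ρ, ρ * r, ρ * s, ρ • a) =
      dualExponentObj R P W q d Δ ρ r s a +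
      ∑ x, ∑ y, margXY V (x, y) * log (margXY V (x, y) / (P x * W x y *
        (tiltSum P q d Δ r s a x y ^ ρ / outputSum P W q d Δ ρ r s a x))) +
      ρ * ∑ x, ∑ y, ∑ x', V (x, x', y) * log (V (x, x', y) / (P x' * margXY V (x, y) *
        (exp (tilt q d Δ r s a x x' y) / tiltSum P q d Δ r s a x y))) := by
  have hA := tiltSum_pos q d Δ hP r s a
  have hB := outputSum_pos q d Δ hP hW ρ r s a
  -- The terms in `log (tiltSum ..)` appear here with factor `-ρ` and in `h₂` with factor `1`, so
  -- they cancel once `h₂` is multiplied by `ρ`.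
  have h₁ : ∑ x, ∑ y, margXY V (x, y) * log (margXY V (x, y) / (P x * W x y *
        (tiltSum P q d Δ r s a x y ^ ρ / outputSum P W q d Δ ρ r s a x))) =
      channelDiv P W V - ρ * ∑ x, ∑ y, margXY V (x, y) * log (tiltSum P q d Δ r s a x y) +
        ∑ x, P x * log (outputSum P W q d Δ ρ r s a x) := by
    have hPx : ∑ x, P x * log (outputSum P W q d Δ ρ r s a x) =
        ∑ x, ∑ y, margXY V (x, y) * log (outputSum P W q d Δ ρ r s a x) := by
      refine Finset.sum_congr rfl fun x _ => ?_
      rw [← Finset.sum_mul, sum_margXY hV.2.1]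
    rw [hPx, channelDiv]
    simp only [Finset.mul_sum, ← Finset.sum_sub_distrib, ← Finset.sum_add_distrib]
    refine Finset.sum_congr rfl fun x _ => Finset.sum_congr rfl fun y _ => ?_
    have hAρ := rpow_pos_of_pos (hA x y) ρ
    rw [mul_log_div_mul (div_pos hAρ (hB x)).ne' (margXY_eq_zero_of_mem hV),
      log_div hAρ.ne' (hB x).ne', log_rpow (hA x y)]
    ring
  have h₂ : ∑ x, ∑ y, ∑ x', V (x, x', y) * log (V (x, x', y) / (P x' * margXY V (x, y) *
        (exp (tilt q d Δ r s a x x' y) / tiltSum P q d Δ r s a x y))) =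
      infoDiv P V + penalty P q d Δ r s a V +
        ∑ x, ∑ y, margXY V (x, y) * log (tiltSum P q d Δ r s a x y) := by
    rw [penalty_eq q d Δ hV.2.1 hV.1.2, infoDiv]
    have : ∀ x y, margXY V (x, y) * log (tiltSum P q d Δ r s a x y) =
        ∑ x', V (x, x', y) * log (tiltSum P q d Δ r s a x y) := fun x y => by
      rw [← Finset.sum_mul]
      rfl
    simp only [this, ← Finset.sum_neg_distrib, ← Finset.sum_add_distrib]
    refine Finset.sum_congr rfl fun x _ => Finset.sum_congr rfl fun y _ =>
      Finset.sum_congr rfl fun x' _ => ?_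
    rw [mul_log_div_mul (div_pos (exp_pos _) (hA x y)).ne' (eq_zero_of_mem hV),
      log_div (exp_ne_zero _) (hA x y).ne', log_exp]
    ring
  rw [h₁, h₂, lagrangian, penalty_mul, dualExponentObj_eq]
  ring

/-- The joint mass function minimizing the Lagrangian. -/
def tiltedLaw (P : X → ℝ) (W : X → Y → ℝ) (q : X → Y → ℝ) (d : X → X → ℝ) (Δ ρ r s : ℝ)
    (a : X → ℝ) : X × X × Y → ℝ := fun z =>
  P z.1 * W z.1 z.2.2 *
      (tiltSum P q d Δ r s a z.1 z.2.2 ^ ρ / outputSum P W q d Δ ρ r s a z.1) *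
    (P z.2.1 * (exp (tilt q d Δ r s a z.1 z.2.1 z.2.2) / tiltSum P q d Δ r s a z.1 z.2.2))

theorem margXY_tiltedLaw (hP : P ∈ stdSimplex ℝ X) (ρ r s : ℝ) (a : X → ℝ) (x : X) (y : Y) :
    margXY (tiltedLaw P W q d Δ ρ r s a) (x, y) = P x * W x y *
      (tiltSum P q d Δ r s a x y ^ ρ / outputSum P W q d Δ ρ r s a x) := by
  have h : ∑ x', P x' * (exp (tilt q d Δ r s a x x' y) / tiltSum P q d Δ r s a x y) = 1 := by
    simp only [← mul_div_assoc]
    rw [← Finset.sum_div, ← tiltSum_eq, div_self (tiltSum_pos q d Δ hP r s a x y).ne']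
  simp only [margXY, tiltedLaw]
  rw [← Finset.mul_sum, h, mul_one]

theorem tiltedLaw_mem (hP : P ∈ stdSimplex ℝ X) (hW : ∀ x, W x ∈ stdSimplex ℝ Y) (ρ r s : ℝ)
    (a : X → ℝ) : tiltedLaw P W q d Δ ρ r s a ∈ supportedSet P W := by
  have hA := tiltSum_pos q d Δ hP r s a
  have hB := outputSum_pos q d Δ hP hW ρ r s a
  have hm : fstMarg (margXXt (tiltedLaw P W q d Δ ρ r s a)) = P := by
    ext x
    rw [← fstMarg_margXY, fstMarg]
    simp only [margXY_tiltedLaw q d Δ hP, mul_assoc]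
    rw [← Finset.mul_sum]
    simp only [← mul_div_assoc]
    rw [← Finset.sum_div, ← outputSum, div_self (hB x).ne', mul_one]
  refine ⟨⟨fun z => ?_, ?_⟩, hm, fun x x' y h => ?_⟩
  · have := hP.1 z.1
    have := hP.1 z.2.1
    have := (hW z.1).1 z.2.2
    have := hA z.1 z.2.2
    have := hB z.1
    unfold tiltedLaw
    positivity
  · rw [← hP.2, Fintype.sum_prod_type]
    refine Finset.sum_congr rfl fun x _ => ?_
    conv_rhs => rw [← hm]
    rw [Fintype.sum_prod_type]
    rfl
  · rcases h with h | h <;> simp [tiltedLaw, h]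

theorem dualExponentObj_le_lagrangian (hP : P ∈ stdSimplex ℝ X) (hW : ∀ x, W x ∈ stdSimplex ℝ Y)
    {V : X × X × Y → ℝ} (hV : V ∈ supportedSet P W) (R r s : ℝ) {ρ : ℝ} (hρ : 0 ≤ ρ)
    (a : X → ℝ) : dualExponentObj R P W q d Δ ρ r s a ≤
      lagrangian R P W q d Δ V (ρ, ρ * r, ρ * s, ρ • a) := by
  have hA := tiltSum_pos q d Δ hP r s a
  have hB := outputSum_pos q d Δ hP hW ρ r s a
  have hT := tiltedLaw_mem q d Δ hP hW ρ r s a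
  rw [lagrangian_eq q d Δ hP hW hV, add_assoc]
  refine le_add_of_nonneg_right (add_nonneg ?_ (mul_nonneg hρ ?_))
  -- Gibbs' inequality: the reference is the `XY` marginal of the tilted law, which has the same row
  -- sums `P x`, so the lower bounds add up to zero.
  · refine le_trans (le_of_eq ?_) (Finset.sum_le_sum fun x _ => Finset.sum_le_sum fun y _ =>
      sub_le_mul_log_div (margXY_nonneg hV.1.1 (x, y)) ?_ ?_)
    · simp only [Finset.sum_sub_distrib, sum_margXY hV.2.1, ← margXY_tiltedLaw q d Δ hP,
        sum_margXY hT.2.1, sub_self, Finset.sum_const_zero]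
    · rw [← margXY_tiltedLaw q d Δ hP]
      exact margXY_nonneg hT.1.1 _
    · exact fun h => margXY_eq_zero_of_mem hV ((mul_eq_zero.1 h).resolve_right
        (div_pos (rpow_pos_of_pos (hA x y) ρ) (hB x)).ne')
  -- Gibbs' inequality again, for each `(x, y)`: the reference sums over `x'` to `margXY V (x, y)`.
  · refine Finset.sum_nonneg fun x _ => Finset.sum_nonneg fun y _ => ?_
    refine le_trans (le_of_eq ?_) (Finset.sum_le_sum fun x' _ =>
      sub_le_mul_log_div (hV.1.1 (x, x', y)) ?_ ?_)
    · have : ∑ x', P x' * margXY V (x, y) *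
          (exp (tilt q d Δ r s a x x' y) / tiltSum P q d Δ r s a x y) = margXY V (x, y) := by
        calc _ = margXY V (x, y) * ((∑ x', P x' * exp (tilt q d Δ r s a x x' y)) /
              tiltSum P q d Δ r s a x y) := by
              rw [Finset.sum_div, Finset.mul_sum]
              exact Finset.sum_congr rfl fun _ _ => by ring
          _ = _ := by rw [← tiltSum_eq, div_self (hA x y).ne', mul_one]
      rw [Finset.sum_sub_distrib, this]
      simp [margXY]
    · exact mul_nonneg (mul_nonneg (hP.1 x') (margXY_nonneg hV.1.1 _))
        (div_pos (exp_pos _) (hA x y)).le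
    · exact fun h => eq_zero_of_mem hV ((mul_eq_zero.1 h).resolve_right
        (div_pos (exp_pos _) (hA x y)).ne')

theorem lagrangian_tiltedLaw (hP : P ∈ stdSimplex ℝ X) (hW : ∀ x, W x ∈ stdSimplex ℝ Y)
    (R ρ r s : ℝ) (a : X → ℝ) :
    lagrangian R P W q d Δ (tiltedLaw P W q d Δ ρ r s a) (ρ, ρ * r, ρ * s, ρ • a) =
      dualExponentObj R P W q d Δ ρ r s a := by
  rw [lagrangian_eq q d Δ hP hW (tiltedLaw_mem q d Δ hP hW ρ r s a)]
  have h : ∀ x x' y, P x' * margXY (tiltedLaw P W q d Δ ρ r s a) (x, y) *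
      (exp (tilt q d Δ r s a x x' y) / tiltSum P q d Δ r s a x y) =
        tiltedLaw P W q d Δ ρ r s a (x, x', y) := fun x x' y => by
    rw [margXY_tiltedLaw q d Δ hP, tiltedLaw]
    ring
  simp only [h, ← margXY_tiltedLaw q d Δ hP, mul_log_div_self, Finset.sum_const_zero, mul_zero,
    add_zero]

theorem iInf_lagrangian (hP : P ∈ stdSimplex ℝ X) (hW : ∀ x, W x ∈ stdSimplex ℝ Y)
    (R r s : ℝ) {ρ : ℝ} (hρ : 0 ≤ ρ) (a : X → ℝ) :
    (⨅ V ∈ supportedSet P W,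
      (lagrangian R P W q d Δ V (ρ, ρ * r, ρ * s, ρ • a) : EReal)) =
      (dualExponentObj R P W q d Δ ρ r s a : EReal) := by
  refine le_antisymm ?_ (le_iInf₂ fun V hV => EReal.coe_le_coe_iff.2
    (dualExponentObj_le_lagrangian q d Δ hP hW hV R r s hρ a))
  rw [← lagrangian_tiltedLaw q d Δ hP hW]
  exact iInf₂_le _ (tiltedLaw_mem q d Δ hP hW ρ r s a)

end gibbs

/-! ### The primal problem -/

section primal

variable {P : X → ℝ} {W : X → Y → ℝ} {V : X × X × Y → ℝ}

theorem sum_sub_le_relEntropy {p q : A → ℝ} (hp : ∀ a, 0 ≤ p a) (hq : ∀ a, 0 ≤ q a) :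
    ((∑ a, p a - ∑ a, q a : ℝ) : EReal) ≤ relEntropy p q := by
  unfold relEntropy
  split_ifs with h
  · rw [← Finset.sum_sub_distrib]
    exact EReal.coe_le_coe_iff.2
      (Finset.sum_le_sum fun a _ => sub_le_mul_log_div (hp a) (hq a) (h a))
  · exact le_top

theorem condRelEntropy_term_nonneg (hP : P ∈ stdSimplex ℝ X) (hW : ∀ x, W x ∈ stdSimplex ℝ Y)
    (hV : ∀ z, 0 ≤ V z) (hm : fstMarg (margXXt V) = P) (x : X) :
    0 ≤ (P x : EReal) * relEntropy (condMarg (margXY V) x) (W x) := by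
  rcases eq_or_ne (P x) 0 with h | h
  · simp [h]
  refine mul_nonneg (EReal.coe_nonneg.2 (hP.1 x)) ?_
  have hc : ∑ y, condMarg (margXY V) x y = 1 := by
    simp only [condMarg]
    rw [← Finset.sum_div, sum_margXY hm, fstMarg_margXY, hm, div_self h]
  have := sum_sub_le_relEntropy (p := condMarg (margXY V) x) (q := W x)
    (fun y => div_nonneg (margXY_nonneg hV _) (by rw [fstMarg_margXY, hm]; exact hP.1 x)) (hW x).1
  rwa [hc, (hW x).2, sub_self, EReal.coe_zero] at this

theorem condRelEntropy_eq (hV : V ∈ supportedSet P W) :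
    condRelEntropy (condMarg (margXY V)) W P = (channelDiv P W V : EReal) := by
  have hm := hV.2.1
  have hsum : ∀ f : X → ℝ, ((∑ x, f x : ℝ) : EReal) = ∑ x, (f x : EReal) :=
    fun f => map_sum (⟨⟨Real.toEReal, EReal.coe_zero⟩, EReal.coe_add⟩ : ℝ →+ EReal) f _
  rw [condRelEntropy, channelDiv, hsum]
  refine Finset.sum_congr rfl fun x _ => ?_
  rcases eq_or_ne (P x) 0 with h | h
  · simp [h, margXY_eq_zero_of_fst hV.1.1 hm h]
  have hac : ∀ y, W x y = 0 → condMarg (margXY V) x y = 0 := fun y hy => by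
    rw [condMarg, margXY_eq_zero_of_mem hV (by rw [hy, mul_zero]), zero_div]
  rw [relEntropy, if_pos hac, ← EReal.coe_mul, Finset.mul_sum]
  congr 1
  refine Finset.sum_congr rfl fun y _ => ?_
  rw [condMarg, fstMarg_margXY, hm, ← mul_assoc, mul_div_cancel₀ _ h, div_div]

/-- A violating mass cannot sit at `P x' = 0`, since `V_X̃ = P`. So `W x y = 0` at a point of
positive mass with `P x > 0`, and absolute continuity fails in that summand; the other summands are
nonnegative. -/
theorem condRelEntropy_eq_top (hP : P ∈ stdSimplex ℝ X) (hW : ∀ x, W x ∈ stdSimplex ℝ Y)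
    (hV : V ∈ stdSimplex ℝ (X × X × Y)) (hm : fstMarg (margXXt V) = P)
    (hm' : sndMarg (margXXt V) = P) (h : V ∉ supportedSet P W) :
    condRelEntropy (condMarg (margXY V)) W P = ⊤ := by
  obtain ⟨x, x', y, hz, hne⟩ : ∃ x x' y, (W x y = 0 ∨ P x' = 0) ∧ V (x, x', y) ≠ 0 := by
    by_contra! h'
    exact h ⟨hV, hm, h'⟩
  have hx' : P x' ≠ 0 := fun e => hne <| by
    rw [← hm', sndMarg] at e
    have e' := (Finset.sum_eq_zero_iff_of_nonneg
      fun _ _ => Finset.sum_nonneg fun _ _ => hV.1 _).1 e x (Finset.mem_univ _)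
    exact (Finset.sum_eq_zero_iff_of_nonneg fun _ _ => hV.1 _).1 e' y (Finset.mem_univ _)
  have hy : margXY V (x, y) ≠ 0 := fun e => hne (eq_zero_of_margXY hV.1 e x')
  have hx : P x ≠ 0 := fun e => hy (margXY_eq_zero_of_fst hV.1 hm e y)
  refine top_le_iff.1 (le_trans (le_of_eq ?_) (Finset.single_le_sum
    (fun i _ => condRelEntropy_term_nonneg hP hW hV.1 hm i) (Finset.mem_univ x)))
  rw [relEntropy, if_neg, EReal.coe_mul_top_of_pos ((hP.1 x).lt_of_ne' hx)]
  intro hac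
  have := hac y (hz.resolve_right hx')
  rw [condMarg, fstMarg_margXY, hm] at this
  exact div_ne_zero hy hx this

theorem mutualInfo_regroup (hm' : sndMarg (margXXt V) = P) :
    mutualInfo (regroup V) = infoDiv P V := by
  have h₁ : ∀ x', fstMarg (regroup V) x' = P x' := fun x' => by
    rw [← hm', fstMarg, sndMarg, Fintype.sum_prod_type]
    rfl
  have h₂ : ∀ x y, sndMarg (regroup V) (x, y) = margXY V (x, y) := fun x y => rfl
  simp only [mutualInfo, infoDiv, Fintype.sum_prod_type, h₁, h₂, regroup]
  rw [Finset.sum_comm]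
  exact Finset.sum_congr rfl fun x _ => Finset.sum_comm

variable (R : ℝ) (q : X → Y → ℝ) (d : X → X → ℝ) (Δ : ℝ)

theorem exponentObj_eq (hV : V ∈ supportedSet P W) (hm' : sndMarg (margXXt V) = P) :
    exponentObj R P W V = ((channelDiv P W V + max (infoDiv P V - R) 0 : ℝ) : EReal) := by
  rw [exponentObj, condRelEntropy_eq hV, mutualInfo_regroup hm', EReal.coe_add]

theorem exponentObj_eq_top (hP : P ∈ stdSimplex ℝ X) (hW : ∀ x, W x ∈ stdSimplex ℝ Y)
    {q : (X × Y → ℝ) → ℝ} {d : (X × X → ℝ) → ℝ} (hV : V ∈ exponentSet P q d Δ)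
    (h : V ∉ supportedSet P W) : exponentObj R P W V = ⊤ := by
  rw [exponentObj, condRelEntropy_eq_top hP hW hV.1 hV.2.1 hV.2.2.1 h, EReal.top_add_coe]

theorem zero_le_ERGV (hP : P ∈ stdSimplex ℝ X) (hW : ∀ x, W x ∈ stdSimplex ℝ Y)
    (q : (X × Y → ℝ) → ℝ) (d : (X × X → ℝ) → ℝ) : 0 ≤ ERGV R P W q d Δ :=
  le_iInf₂ fun _ hV => add_nonneg
    (Finset.sum_nonneg fun x _ => condRelEntropy_term_nonneg hP hW hV.1.1 hV.2.1 x)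
    (EReal.coe_nonneg.2 (le_max_right _ _))

theorem nonpos_of_forall_add_mul_le {C δ z : ℝ} (h : ∀ t, 0 ≤ t → C + t * δ ≤ z) : δ ≤ 0 := by
  by_contra! hδ
  -- At this `t` the left side is `C + |z - C| + 1`, which exceeds `z`.
  have h' := h ((|z - C| + 1) / δ) (by positivity)
  rw [div_mul_cancel₀ _ hδ.ne'] at h'
  linarith [le_abs_self (z - C)]

theorem lagrangian_le (hV : V ∈ exponentSet P (additive q) (additive d) Δ)
    {m : ℝ × ℝ × ℝ × (X → ℝ)} (hm : m ∈ multipliers X) :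
    lagrangian R P W q d Δ V m ≤ channelDiv P W V + max (infoDiv P V - R) 0 := by
  obtain ⟨⟨h0, h1⟩, hr, hs⟩ := hm
  obtain ⟨-, -, hm', hq, hd⟩ := hV
  have e₁ : m.2.2.1 * (additive q (margXY V) - additive q (margXtY V)) ≤ 0 :=
    mul_nonpos_of_nonneg_of_nonpos hs (by linarith)
  have e₂ : m.2.1 * (Δ - additive d (margXXt V)) ≤ 0 :=
    mul_nonpos_of_nonneg_of_nonpos hr (by linarith)
  have e₃ : m.1 * (infoDiv P V - R) ≤ max (infoDiv P V - R) 0 := by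
    rcases le_total 0 (infoDiv P V - R) with h | h
    · exact (mul_le_of_le_one_left h h1).trans (le_max_left _ _)
    · exact (mul_nonpos_of_nonneg_of_nonpos h0.le h).trans (le_max_right _ _)
  simp only [lagrangian, penalty, hm', sub_self, mul_zero, Finset.sum_const_zero]
  linarith

/-- A uniform bound on the Lagrangian forces feasibility and bounds the objective. -/
theorem of_lagrangian_le (hV : V ∈ supportedSet P W) {z : ℝ}
    (h : ∀ m ∈ multipliers X, lagrangian R P W q d Δ V m ≤ z) :
    V ∈ exponentSet P (additive q) (additive d) Δ ∧
      channelDiv P W V + max (infoDiv P V - R) 0 ≤ z := by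
  have h1 : (1 : ℝ) ∈ Ioc (0 : ℝ) 1 := ⟨one_pos, le_rfl⟩
  have hq : additive q (margXY V) - additive q (margXtY V) ≤ 0 :=
    nonpos_of_forall_add_mul_le (C := channelDiv P W V + (infoDiv P V - R)) (z := z) fun t ht => by
      simpa [lagrangian, penalty] using h (1, 0, t, 0) ⟨h1, le_rfl, ht⟩
  have hd : Δ - additive d (margXXt V) ≤ 0 :=
    nonpos_of_forall_add_mul_le (C := channelDiv P W V + (infoDiv P V - R)) (z := z) fun t ht => by
      simpa [lagrangian, penalty] using h (1, t, 0, 0) ⟨h1, ht, le_rfl⟩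
  have hm : ∑ x, (P x - sndMarg (margXXt V) x) * (P x - sndMarg (margXXt V) x) ≤ 0 :=
    nonpos_of_forall_add_mul_le (C := channelDiv P W V + (infoDiv P V - R)) (z := z) fun t _ => by
      -- Taking `a` along the marginal discrepancy turns the penalty into `t` times its squared
      -- norm, so a bound for all `t` forces the discrepancy to vanish.
      have := h (1, 0, 0, fun x => t * (P x - sndMarg (margXXt V) x)) ⟨h1, le_rfl, le_rfl⟩
      simpa [lagrangian, penalty, mul_assoc, ← Finset.mul_sum] using this
  have hm' : sndMarg (margXXt V) = P := by
    ext x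
    have e := (Finset.sum_eq_zero_iff_of_nonneg fun x _ => mul_self_nonneg _).1
      (le_antisymm hm (Finset.sum_nonneg fun x _ => mul_self_nonneg _)) x (Finset.mem_univ _)
    linarith [mul_self_eq_zero.1 e]
  refine ⟨⟨hV.1, hV.2.1, hm', by linarith, by linarith⟩, ?_⟩
  have hρ : ∀ ρ ∈ Ioc (0 : ℝ) 1, channelDiv P W V + ρ * (infoDiv P V - R) ≤ z := fun ρ hρ => by
    simpa [lagrangian, penalty] using h (ρ, 0, 0, 0) ⟨hρ, le_rfl, le_rfl⟩
  rcases le_or_gt 0 (infoDiv P V - R) with hI | hI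
  · rw [max_eq_left hI]
    simpa using hρ 1 h1
  · rw [max_eq_right hI.le, add_zero]
    by_contra! hz
    have he : 0 < channelDiv P W V - z := by linarith
    have hc : 0 < R - infoDiv P V := by linarith
    have hs := add_pos he hc
    -- With `e` the assumed excess of `channelDiv` over `z` and `c = R - infoDiv > 0`, the choice `ρ
    -- = e / (e + c)` is positive and leaves the excess `e - ρ c = e² / (e + c) > 0`. This replaces
    -- letting `ρ` tend to `0`.
    have key := hρ ((channelDiv P W V - z) / (channelDiv P W V - z + (R - infoDiv P V)))
      ⟨div_pos he hs, (div_le_one hs).2 (by linarith)⟩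
    rw [div_mul_eq_mul_div, ← sub_nonneg] at key
    have : z - (channelDiv P W V + (channelDiv P W V - z) * (infoDiv P V - R) /
        (channelDiv P W V - z + (R - infoDiv P V))) =
        -((channelDiv P W V - z) ^ 2 / (channelDiv P W V - z + (R - infoDiv P V))) := by
      field_simp
      ring
    rw [this] at key
    have := div_pos (pow_pos he 2) hs
    linarith

theorem ERGV_eq_iInf_iSup (hP : P ∈ stdSimplex ℝ X) (hW : ∀ x, W x ∈ stdSimplex ℝ Y) :
    ERGV R P W (additive q) (additive d) Δ = ⨅ V ∈ supportedSet P W,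
      ⨆ m ∈ multipliers X, (lagrangian R P W q d Δ V m : EReal) := by
  refine le_antisymm (le_iInf₂ fun V hV => ?_) (le_iInf₂ fun V hV => ?_)
  -- Testing against reals above the supremum makes the case of supremum `⊤` vacuous.
  · refine EReal.le_of_forall_lt_iff_le.1 fun z hz => ?_
    obtain ⟨hV', hz'⟩ := of_lagrangian_le R q d Δ hV (z := z) fun m hm =>
      EReal.coe_le_coe_iff.1 ((le_iSup₂ (f := fun m (_ : m ∈ multipliers X) =>
        (lagrangian R P W q d Δ V m : EReal)) m hm).trans hz.le)
    refine (iInf₂_le V hV').trans ?_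
    rw [exponentObj_eq R hV hV'.2.2.1]
    exact EReal.coe_le_coe_iff.2 hz'
  · by_cases h : V ∈ supportedSet P W
    · refine (iInf₂_le V h).trans (iSup₂_le fun m hm => ?_)
      rw [exponentObj_eq R h hV.2.2.1]
      exact EReal.coe_le_coe_iff.2 (lagrangian_le R q d Δ hV hm)
    · rw [exponentObj_eq_top R Δ hP hW hV h]
      exact le_top

theorem supportedSet_nonempty (hP : P ∈ stdSimplex ℝ X) (hW : ∀ x, W x ∈ stdSimplex ℝ Y) :
    (supportedSet P W).Nonempty :=
  -- With all parameters zero the tilted law is `P(x) W(y|x) P(x')`.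
  ⟨_, tiltedLaw_mem 0 0 0 hP hW 0 0 0 0⟩

/-- The dual form of the exponent. -/
theorem ERGV_eq_iSup (hP : P ∈ stdSimplex ℝ X) (hW : ∀ x, W x ∈ stdSimplex ℝ Y) :
    ERGV R P W (additive q) (additive d) Δ =
      ⨆ (ρ : ℝ) (_ : ρ ∈ Icc (0 : ℝ) 1) (r : ℝ) (_ : 0 ≤ r) (s : ℝ) (_ : 0 ≤ s) (a : X → ℝ),
        ((dualExponentObj R P W q d Δ ρ r s a : ℝ) : EReal) := by
  have hE : ERGV R P W (additive q) (additive d) Δ = ⨆ m ∈ multipliers X,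
      ⨅ V ∈ supportedSet P W, (lagrangian R P W q d Δ V m : EReal) := by
    rw [ERGV_eq_iInf_iSup R q d Δ hP hW, iInf_iSup_lagrangian R q d Δ hP.1 (fun x => (hW x).1)
      (supportedSet_nonempty hP hW)]
  refine le_antisymm ?_ ?_
  · rw [hE]
    refine iSup₂_le fun m hm => ?_
    obtain ⟨ρ, r, s, a⟩ := m
    obtain ⟨⟨h0, h1⟩, hr, hs⟩ := hm
    dsimp only at h0 h1 hr hs
    -- Undoes the scaling by `ρ`; this is where `ρ > 0` is needed.
    have := iInf_lagrangian q d Δ hP hW R (r / ρ) (s / ρ) h0.le (ρ⁻¹ • a)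
    rw [mul_div_cancel₀ _ h0.ne', mul_div_cancel₀ _ h0.ne', smul_inv_smul₀ h0.ne'] at this
    rw [this]
    exact le_iSup_of_le ρ <| le_iSup_of_le ⟨h0.le, h1⟩ <| le_iSup_of_le (r / ρ) <|
      le_iSup_of_le (div_nonneg hr h0.le) <| le_iSup_of_le (s / ρ) <|
      le_iSup_of_le (div_nonneg hs h0.le) <| le_iSup_of_le (ρ⁻¹ • a) le_rfl
  · refine iSup₂_le fun ρ hρ => iSup₂_le fun r hr => iSup₂_le fun s hs => iSup_le fun a => ?_
    -- At `ρ = 0` the dual value is `0`, covered by nonnegativity of the exponent rather than by the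
    -- minimax identity.
    rcases hρ.1.eq_or_lt with rfl | h0
    · have : dualExponentObj R P W q d Δ 0 r s a = 0 := by
        simp [dualExponentObj, (hW _).2]
      rw [this]
      exact zero_le_ERGV R Δ hP hW _ _
    · rw [hE, ← iInf_lagrangian q d Δ hP hW R r s h0.le a]
      exact le_iSup₂ (f := fun m (_ : m ∈ multipliers X) =>
        ⨅ V ∈ supportedSet P W, (lagrangian R P W q d Δ V m : EReal)) (ρ, ρ * r, ρ * s, ρ • a)
        ⟨⟨h0, hρ.2⟩, mul_nonneg h0.le hr, mul_nonneg h0.le hs⟩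

/-! ### Attainment of the minimum in the exponent. -/

theorem isClosed_exponentSet (P : X → ℝ) :
    IsClosed (exponentSet P (additive q) (additive d) Δ) := by
  have h₁ : IsClosed {V : X × X × Y → ℝ | fstMarg (margXXt V) = P} :=
    isClosed_eq (by unfold fstMarg margXXt; fun_prop) continuous_const
  have h₂ : IsClosed {V : X × X × Y → ℝ | sndMarg (margXXt V) = P} :=
    isClosed_eq (by unfold sndMarg margXXt; fun_prop) continuous_const
  have h₃ : IsClosed {V : X × X × Y → ℝ | additive q (margXtY V) ≥ additive q (margXY V)} :=
    isClosed_le (by unfold additive margXY; fun_prop) (by unfold additive margXtY; fun_prop)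
  have h₄ : IsClosed {V : X × X × Y → ℝ | additive d (margXXt V) ≥ Δ} :=
    isClosed_le continuous_const (by unfold additive margXXt; fun_prop)
  exact (isClosed_stdSimplex ℝ _).inter (h₁.inter (h₂.inter (h₃.inter h₄)))

/-- The minimum defining the exponent is attained. -/
theorem exists_exponentObj_eq_ERGV (hP : P ∈ stdSimplex ℝ X) (hW : ∀ x, W x ∈ stdSimplex ℝ Y)
    (hne : (exponentSet P (additive q) (additive d) Δ).Nonempty) :
    ∃ V ∈ exponentSet P (additive q) (additive d) Δ,
      exponentObj R P W V = ERGV R P W (additive q) (additive d) Δ := by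
  suffices ∃ V ∈ exponentSet P (additive q) (additive d) Δ,
      ∀ U ∈ exponentSet P (additive q) (additive d) Δ,
        exponentObj R P W V ≤ exponentObj R P W U by
    obtain ⟨V, hV, h⟩ := this
    exact ⟨V, hV, le_antisymm (le_iInf₂ h) (iInf₂_le V hV)⟩
  -- If no feasible law is supported, the objective is `⊤` on the whole constraint set and any
  -- feasible law is a minimizer.
  by_cases hs : (supportedSet P W ∩ exponentSet P (additive q) (additive d) Δ).Nonempty
  · obtain ⟨V, hV, hmin⟩ := ((isCompact_supportedSet P W).inter_right
      (isClosed_exponentSet q d Δ P)).exists_isMinOn hs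
      (f := fun V => channelDiv P W V + max (infoDiv P V - R) 0)
      (((continuousOn_channelDiv P W).add (((continuousOn_infoDiv P W).sub
        continuousOn_const).sup continuousOn_const)).mono inter_subset_left)
    refine ⟨V, hV.2, fun U hU => ?_⟩
    by_cases hU' : U ∈ supportedSet P W
    · rw [exponentObj_eq R hV.1 hV.2.2.2.1, exponentObj_eq R hU' hU.2.2.1]
      exact EReal.coe_le_coe_iff.2 (hmin ⟨hU', hU⟩)
    · rw [exponentObj_eq_top R Δ hP hW hU hU']
      exact le_top
  · obtain ⟨V, hV⟩ := hne
    refine ⟨V, hV, fun U hU => ?_⟩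
    rw [exponentObj_eq_top R Δ hP hW hU fun h => hs ⟨U, h, hU⟩]
    exact le_top

end primal

/-! ### The rate threshold, as the exponent of a channel with a single output -/

section rate

variable {P : X → ℝ} (d : X → X → ℝ) (Δ : ℝ)

theorem margXXt_lift (V : X × X → ℝ) :
    margXXt (fun z : X × X × Unit => V (z.1, z.2.1)) = V := by
  ext z
  simp [margXXt]

theorem margXXt_mem_rateSet {V : X × X × Unit → ℝ}
    (hV : V ∈ exponentSet P (additive 0) (additive (-d)) (-Δ)) :
    margXXt V ∈ rateSet P (additive d) Δ := by
  obtain ⟨h, h₁, h₂, -, h₃⟩ := hV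
  refine ⟨⟨fun z => Finset.sum_nonneg fun _ _ => h.1 _, ?_⟩, ?_, h₁, h₂⟩
  · rw [← h.2]
    simp [margXXt, Fintype.sum_prod_type]
  · simp only [additive, Pi.neg_apply, mul_neg, Finset.sum_neg_distrib] at h₃ ⊢
    linarith

theorem lift_mem_exponentSet {V : X × X → ℝ} (hV : V ∈ rateSet P (additive d) Δ) :
    (fun z : X × X × Unit => V (z.1, z.2.1)) ∈
      exponentSet P (additive 0) (additive (-d)) (-Δ) := by
  obtain ⟨h, h₃, h₁, h₂⟩ := hV
  refine ⟨⟨fun z => h.1 _, ?_⟩, by rw [margXXt_lift, h₁], by rw [margXXt_lift, h₂], ?_, ?_⟩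
  · rw [← h.2]
    simp [Fintype.sum_prod_type]
  · simp [additive]
  · rw [margXXt_lift]
    simp only [additive, Pi.neg_apply, mul_neg, Finset.sum_neg_distrib] at h₃ ⊢
    linarith

theorem infoDiv_unit {V : X × X × Unit → ℝ} (hm : fstMarg (margXXt V) = P)
    (hm' : sndMarg (margXXt V) = P) : infoDiv P V = mutualInfo (margXXt V) := by
  have h : ∀ x, margXY V (x, ()) = P x := fun x => by
    rw [← hm]
    simp [margXY, fstMarg, margXXt]
  simp only [infoDiv, mutualInfo, hm, hm', h, Finset.univ_unique, Finset.sum_singleton,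
    PUnit.default_eq_unit, margXXt]
  simp only [mul_comm]

/-- A single output makes the channel divergence zero, and the positive part at rate zero disappears
because mutual information is nonnegative. -/
theorem exponentObj_unit (hP : P ∈ stdSimplex ℝ X) {V : X × X × Unit → ℝ}
    (hV : V ∈ exponentSet P (additive 0) (additive (-d)) (-Δ)) :
    exponentObj 0 P 1 V = (mutualInfo (margXXt V) : EReal) := by
  have hW : ∀ x : X, (1 : X → Unit → ℝ) x ∈ stdSimplex ℝ Unit := fun x => ⟨by simp, by simp⟩
  have hs : V ∈ supportedSet P (1 : X → Unit → ℝ) := by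
    refine ⟨hV.1, hV.2.1, fun x x' y h => ?_⟩
    have e : P x' = 0 := h.resolve_left one_ne_zero
    rw [← hV.2.2.1, sndMarg] at e
    have e' := (Finset.sum_eq_zero_iff_of_nonneg
      fun _ _ => Finset.sum_nonneg fun _ _ => hV.1.1 _).1 e x (Finset.mem_univ _)
    exact (Finset.sum_eq_zero_iff_of_nonneg fun _ _ => hV.1.1 _).1 e' y (Finset.mem_univ _)
  have hc : channelDiv P 1 V = 0 := by
    have h : ∀ x, margXY V (x, ()) = P x := fun x => by
      rw [← hV.2.1]
      simp [margXY, fstMarg, margXXt]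
    simp [channelDiv, h]
  have hi : 0 ≤ infoDiv P V := by
    -- With `ρ = 1` and all other parameters zero, the Gibbs bound reads `0 ≤ infoDiv P V`.
    have := dualExponentObj_le_lagrangian (0 : X → Unit → ℝ) d Δ hP hW hs 0 0 0 zero_le_one 0
    simpa [dualExponentObj, lagrangian, penalty, hc, hP.2] using this
  rw [exponentObj_eq 0 hs hV.2.2.1, hc, infoDiv_unit hV.2.1 hV.2.2.1, zero_add, sub_zero,
    max_eq_left]
  rwa [← infoDiv_unit hV.2.1 hV.2.2.1]

theorem rateMin_eq_ERGV (hP : P ∈ stdSimplex ℝ X) :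
    rateMin P (additive d) Δ =
      ERGV 0 P (1 : X → Unit → ℝ) (additive 0) (additive (-d)) (-Δ) := by
  refine le_antisymm (le_iInf₂ fun V hV => ?_) (le_iInf₂ fun V hV => ?_)
  · rw [exponentObj_unit d Δ hP hV]
    exact iInf₂_le _ (margXXt_mem_rateSet d Δ hV)
  · have h := lift_mem_exponentSet d Δ hV
    refine (iInf₂_le _ h).trans (le_of_eq ?_)
    rw [exponentObj_unit d Δ hP h, margXXt_lift]

/-- The normalizations differ by the factor `exp (a x - φ)`, whose logarithm has mean zero under
`P`; `s` drops out because the metric is zero. -/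
theorem dualExponentObj_unit (hP : P ∈ stdSimplex ℝ X) (ρ r s : ℝ) (a : X → ℝ) :
    dualExponentObj 0 P (1 : X → Unit → ℝ) 0 (-d) (-Δ) ρ r s a =
      ρ * dualRateObj P d Δ r a := by
  set φ := ∑ z, P z * a z with hφ
  have hS : ∀ x, ∑ x', P x' * exp (a x' - φ) * exp (-r * (d x x' - Δ)) =
      tiltSum P (0 : X → Unit → ℝ) (-d) (-Δ) r s a x () * exp (a x - φ) := fun x => by
    rw [tiltSum_eq, Finset.sum_mul]
    refine Finset.sum_congr rfl fun x' _ => ?_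
    rw [mul_assoc, mul_assoc, ← exp_add, ← exp_add]
    congr 2
    simp only [tilt, Pi.zero_apply, Pi.neg_apply]
    ring
  have hpos := tiltSum_pos (0 : X → Unit → ℝ) (-d) (-Δ) hP r s a
  rw [dualExponentObj_eq, dualRateObj, ← hφ]
  simp only [hS]
  simp only [log_mul (hpos _ _).ne' (exp_ne_zero _), log_exp, outputSum, Finset.univ_unique,
    Finset.sum_singleton, PUnit.default_eq_unit, Pi.one_apply, one_mul, log_rpow (hpos _ _),
    mul_add, mul_sub, Finset.sum_add_distrib, Finset.sum_sub_distrib]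
  rw [← Finset.sum_mul, hP.2, ← hφ]
  simp only [mul_left_comm _ ρ, ← Finset.mul_sum]
  ring

theorem dualRateObj_zero (hP : P ∈ stdSimplex ℝ X) : dualRateObj P d Δ 0 0 = 0 := by
  simp [dualRateObj, hP.2]

/-- The dual form of the rate threshold. -/
theorem rateMin_eq_iSup (hP : P ∈ stdSimplex ℝ X) :
    rateMin P (additive d) Δ =
      ⨆ (r : ℝ) (_ : 0 ≤ r) (a : X → ℝ), ((dualRateObj P d Δ r a : ℝ) : EReal) := by
  rw [rateMin_eq_ERGV d Δ hP, ERGV_eq_iSup 0 0 (-d) (-Δ) hP fun x => ⟨by simp, by simp⟩]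
  simp only [dualExponentObj_unit d Δ hP]
  refine le_antisymm ?_ ?_
  · refine iSup₂_le fun ρ hρ => iSup₂_le fun r hr => iSup₂_le fun s hs => iSup_le fun a => ?_
    -- A factor `ρ ≤ 1` only lowers a nonnegative value, and a negative value is beaten by `r = 0`,
    -- `a = 0`, which gives `0`.
    rcases le_total 0 (dualRateObj P d Δ r a) with h | h
    · exact le_iSup_of_le r <| le_iSup_of_le hr <| le_iSup_of_le a <|
        EReal.coe_le_coe_iff.2 (mul_le_of_le_one_left h hρ.2)
    · refine le_iSup_of_le 0 <| le_iSup_of_le le_rfl <| le_iSup_of_le 0 <|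
        EReal.coe_le_coe_iff.2 ?_
      rw [dualRateObj_zero d Δ hP]
      exact mul_nonpos_of_nonneg_of_nonpos hρ.1 h
  · refine iSup₂_le fun r hr => iSup_le fun a => ?_
    exact le_iSup_of_le 1 <| le_iSup_of_le ⟨zero_le_one, le_rfl⟩ <| le_iSup_of_le r <|
      le_iSup_of_le hr <| le_iSup_of_le 0 <| le_iSup_of_le le_rfl <| le_iSup_of_le a <|
      by rw [one_mul]

/-- The minimum defining the rate threshold is attained. -/
theorem exists_mutualInfo_eq_rateMin (hP : P ∈ stdSimplex ℝ X)
    (hne : (rateSet P (additive d) Δ).Nonempty) :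
    ∃ V ∈ rateSet P (additive d) Δ, (mutualInfo V : EReal) = rateMin P (additive d) Δ := by
  obtain ⟨V, hV⟩ := hne
  obtain ⟨U, hU, h⟩ := exists_exponentObj_eq_ERGV 0 0 (-d) (-Δ) hP
    (W := (1 : X → Unit → ℝ)) (fun x => ⟨by simp, by simp⟩) ⟨_, lift_mem_exponentSet d Δ hV⟩
  exact ⟨margXXt U, margXXt_mem_rateSet d Δ hU, by
    rw [rateMin_eq_ERGV d Δ hP, ← h, exponentObj_unit d Δ hP hU]⟩

end rate

end RGV

end

theorem theorem2 {X Y : Type*} [Fintype X] [Fintype Y]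
    (P : X → ℝ) (hP : P ∈ stdSimplex ℝ X)
    (W : X → Y → ℝ) (hW : ∀ x, W x ∈ stdSimplex ℝ Y)
    (q : X → Y → ℝ) (d : X → X → ℝ) (Δ R δ : ℝ) :
    -- dual form of the exponent
    (RGV.ERGV R P W (RGV.additive q) (RGV.additive d) Δ =
      ⨆ (ρ : ℝ) (_ : ρ ∈ Set.Icc (0 : ℝ) 1) (r : ℝ) (_ : 0 ≤ r) (s : ℝ) (_ : 0 ≤ s) (a : X → ℝ),
        ((RGV.dualExponentObj R P W q d Δ ρ r s a : ℝ) : EReal)) ∧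
    -- the minimum defining the exponent is attained
    ((RGV.exponentSet P (RGV.additive q) (RGV.additive d) Δ).Nonempty →
      ∃ V ∈ RGV.exponentSet P (RGV.additive q) (RGV.additive d) Δ,
        RGV.exponentObj R P W V = RGV.ERGV R P W (RGV.additive q) (RGV.additive d) Δ) ∧
    -- dual form of the rate threshold
    (RGV.rateMin P (RGV.additive d) Δ =
      ⨆ (r : ℝ) (_ : 0 ≤ r) (a : X → ℝ), ((RGV.dualRateObj P d Δ r a : ℝ) : EReal)) ∧
    -- the minimum defining the rate threshold is attained
    ((RGV.rateSet P (RGV.additive d) Δ).Nonempty →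
      ∃ V ∈ RGV.rateSet P (RGV.additive d) Δ,
        (RGV.mutualInfo V : EReal) = RGV.rateMin P (RGV.additive d) Δ) ∧
    -- equivalence of the two rate conditions
    ((R : EReal) ≤ RGV.rateMin P (RGV.additive d) Δ - ((2 * δ : ℝ) : EReal) ↔
      (R : EReal) ≤ (⨆ (r : ℝ) (_ : 0 ≤ r) (a : X → ℝ),
        ((RGV.dualRateObj P d Δ r a : ℝ) : EReal)) - ((2 * δ : ℝ) : EReal)) := by
  refine ⟨RGV.ERGV_eq_iSup R q d Δ hP hW, RGV.exists_exponentObj_eq_ERGV R q d Δ hP hW,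
    RGV.rateMin_eq_iSup d Δ hP, RGV.exists_mutualInfo_eq_rateMin d Δ hP, ?_⟩
  rw [RGV.rateMin_eq_iSup d Δ hP]
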